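/- A $2$-colored graph $H=(V,E_r,E_b)$ consists of a vertex set $V$ and two sets $E_r,E_b\subseteq\binom V2$ of red and blue edges (a pair may have both colors). A homomorphism between $2$-colored graphs is a map of the vertex sets that sends red edges to red edges and blue edges to blue edges; $H$ is $G$-colorable if there is a homomorphism from $H$ to $G$, and $G$ contains $H$ if there is an injective one. The Turán density of $H$ is $$\pi(H)=\lim_{n\to\infty}\max_{G}\frac{|E_r(G)|+|E_b(G)|}{\binom n2},$$ where $G$ runs over the $2$-colored graphs on $n$ vertices that do not contain $H$. Writing $ab$ for $\{a,b\}$, let $H_8$ be the $2$-colored graph on $\{1,\dots,8\}$ with $$E_r=\{12,13,24,34,16,37,48,25,35,18,46,27\},\qquad E_b=\{56,57,68,78,26,15,47,38,35,18,46,27\},$$ and let $T,T_1,T_2$ be the $2$-colored graphs on $\{1,2,3,4\}$ with - $T$: $E_r=\{12,13,34\}$, $E_b=\{12,23,34\}$; - $T_1$: $E_r=\{12,34,13,24\}$, $E_b=\{12,34,14,23\}$; - $T_2$: $E_r=\{12,14,23,24,34\}$, $E_b=\{12,13,14,23,34\}$. **Lemma.** The limit defining $\pi(H_8)$ exists and $\pi(H_8)=\frac43$.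 Moreover, $H_8$ is $T_1$-colorable and $T_2$-colorable, and $H_8$ is not $T$-colorable. -/

import Mathlib

open Filter Topology

/-- A 2-colored graph `(V, E_r, E_b)`: a set of red edges and a set of blue edges on the vertex
set `V`, without loops; a pair may carry no color, one color, or both colors. -/
structure TwoColoredGraph (V : Type*) where
  /-- the graph of red edges -/
  red : SimpleGraph V
  /-- the graph of blue edges -/
  blue : SimpleGraph V

namespace TwoColoredGraph

/-- The 2-colored graph with vertex set `[n] = {1, …, n}` and the listed red and blue edges; the
pair `(a, b)` in a list stands for the edge `ab`, and `i : Fin n` stands for the vertex `i + 1`. -/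
def ofEdges (n : ℕ) (redEdges blueEdges : List (ℕ × ℕ)) : TwoColoredGraph (Fin n) where
  red := SimpleGraph.fromRel fun i j => ((i : ℕ) + 1, (j : ℕ) + 1) ∈ redEdges
  blue := SimpleGraph.fromRel fun i j => ((i : ℕ) + 1, (j : ℕ) + 1) ∈ blueEdges

/-- `f` is a graph homomorphism from `H` to `G`: it maps red edges to red edges and blue edges
to blue edges. -/
def IsHom {W V : Type*} (H : TwoColoredGraph W) (G : TwoColoredGraph V) (f : W → V) : Prop :=
  (∀ u v, H.red.Adj u v → G.red.Adj (f u) (f v)) ∧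
    ∀ u v, H.blue.Adj u v → G.blue.Adj (f u) (f v)

/-- `H` is `G`-colorable: there is a graph homomorphism from `H` to `G`. -/
def ColorableBy {W V : Type*} (H : TwoColoredGraph W) (G : TwoColoredGraph V) : Prop :=
  ∃ f : W → V, H.IsHom G f

/-- `G` contains (a copy of) `H` as a subgraph. -/
def Contains {V W : Type*} (G : TwoColoredGraph V) (H : TwoColoredGraph W) : Prop :=
  ∃ f : W → V, Function.Injective f ∧ H.IsHom G f

/-- The edge density `h_n(G) = (|E_r(G)| + |E_b(G)|) / (n choose 2)` of a 2-colored graph on `n`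
vertices; an edge with both colors counts twice. -/
noncomputable def edgeDensity {n : ℕ} (G : TwoColoredGraph (Fin n)) : ℝ :=
  ((G.red.edgeSet.ncard : ℝ) + (G.blue.edgeSet.ncard : ℝ)) / (n.choose 2 : ℝ)

/-- `π_n(H)`: the maximum of `h_n(G)` over all `H`-free 2-colored graphs `G` on `n` vertices
(there are finitely many of them). -/
noncomputable def maxDensity {W : Type*} (H : TwoColoredGraph W) (n : ℕ) : ℝ :=
  sSup {d : ℝ | ∃ G : TwoColoredGraph (Fin n), ¬ G.Contains H ∧ d = G.edgeDensity}

/-- The Turán density `π(H) = lim π_n(H)` exists and equals `d`. -/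
def HasTuranDensity {W : Type*} (H : TwoColoredGraph W) (d : ℝ) : Prop :=
  Tendsto (fun n : ℕ => H.maxDensity n) atTop (𝓝 d)

/-- The 2-colored graph `T`. -/
def T : TwoColoredGraph (Fin 4) :=
  ofEdges 4 [(1, 2), (1, 3), (3, 4)] [(1, 2), (2, 3), (3, 4)]

/-- The 2-colored graph `T_1`. -/
def T1 : TwoColoredGraph (Fin 4) :=
  ofEdges 4 [(1, 2), (3, 4), (1, 3), (2, 4)] [(1, 2), (3, 4), (1, 4), (2, 3)]

/-- The 2-colored graph `T_2`. -/
def T2 : TwoColoredGraph (Fin 4) :=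
  ofEdges 4 [(1, 2), (1, 4), (2, 3), (2, 4), (3, 4)] [(1, 2), (1, 3), (1, 4), (2, 3), (3, 4)]

/-- The 2-colored graph `H_8`. -/
def H8 : TwoColoredGraph (Fin 8) :=
  ofEdges 8
    [(1, 2), (1, 3), (2, 4), (3, 4), (1, 6), (3, 7), (4, 8), (2, 5), (3, 5), (1, 8), (4, 6), (2, 7)]
    [(5, 6), (5, 7), (6, 8), (7, 8), (2, 6), (1, 5), (4, 7), (3, 8), (3, 5), (1, 8), (4, 6), (2, 7)]

end TwoColoredGraph

/-!
A uniformly random map into a 2-colored graph `G` turns edge densities and homomorphism densities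
into expectations. If `G` contains no copy of a graph `H` that is `F`-colorable, then the
homomorphism density of `F` in `G` is small: by Jensen's inequality, applied to one vertex of `F`
at a time, it would otherwise force many homomorphisms of `H`, not all of which fail to be
injective. So a large `H8`-free graph has few copies of `T1` and `T2`.

A 2-colored graph without `T1` and `T2` has no 4-cycle of doubly colored pairs whose diagonals are
both colored. Every vertex set `U` in such a graph has a part `S` to which every vertex of `U` sends
at most `4 / 3` colors per vertex on average, and peeling off such parts bounds the number of
colored edges. By averaging over random maps, the bound persists when the copies of `T1` and `T2`
are merely rare.

The complement of the graph underlying `H8` is an 8-cycle, which has no triangle, so three color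
classes cover at most six of the eight vertices and the graph is not 3-colorable. Hence `H8` has no
homomorphism to `T`, nor to the doubled Turán graph with three parts, whose density is at least
`4 / 3`.
-/

open Finset
open scoped BigOperators

section Averaging

variable {ι κ σ V : Type*} [Fintype ι] [DecidableEq ι] [Fintype κ] [DecidableEq κ] [Fintype σ]
  [DecidableEq σ] [Fintype V]

theorem expect_pow_card_eq_expect_prod (f : V → ℝ) :
    (𝔼 x, f x) ^ Fintype.card σ = 𝔼 p : σ → V, ∏ s, f (p s) := by
  simp only [Fintype.expect_eq_sum_div_card, div_pow, Fintype.card_fun, Nat.cast_pow]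
  rw [← Fintype.piFinset_univ, ← prod_univ_sum, prod_const, card_univ]

theorem pow_expect_le_expect_pow [Nonempty V] {f : V → ℝ} (hf : ∀ x, 0 ≤ f x) (n : ℕ) :
    (𝔼 x, f x) ^ n ≤ 𝔼 x, f x ^ n := by
  have key := Real.pow_arith_mean_le_arith_mean_pow univ (fun _ : V => (Fintype.card V : ℝ)⁻¹) f
    (fun _ _ => by positivity) (by simp) (fun x _ => hf x) n
  simpa only [Fintype.expect_eq_sum_div_card, div_eq_inv_mul, mul_sum] using key

theorem expect_fin_succ_arrow {k : ℕ} (f : (Fin (k + 1) → V) → ℝ) :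
    𝔼 ψ, f ψ = 𝔼 x, 𝔼 ψ : Fin k → V, f (Fin.cons x ψ) := by
  rw [← expect_product', univ_product_univ]
  exact (Fintype.expect_equiv (Fin.consEquiv fun _ => V) _ _ fun _ => rfl).symm

theorem expect_comp_injective [Nonempty V] {q : κ → ι} (hq : q.Injective) (f : (κ → V) → ℝ) :
    𝔼 φ : ι → V, f (φ ∘ q) = 𝔼 ψ, f ψ := by
  classical
  let e : (ι → V) ≃ (κ → V) × ({i // i ∉ Set.range q} → V) :=
    (Equiv.piEquivPiSubtypeProd (· ∈ Set.range q) fun _ => V).trans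
      (((Equiv.ofInjective q hq).symm.arrowCongr (Equiv.refl V)).prodCongr (Equiv.refl _))
  refine (Fintype.expect_equiv e (fun φ => f (φ ∘ q)) (fun p => f p.1) fun φ => rfl).trans ?_
  rw [← univ_product_univ, expect_product]
  simp only [Fintype.expect_const]

theorem expect_apply_apply [Nonempty V] {i j : ι} (hij : i ≠ j) (f : V → V → ℝ) :
    𝔼 φ : ι → V, f (φ i) (φ j) = 𝔼 x, 𝔼 y, f x y := by
  have hq : Function.Injective ![i, j] := by
    simpa [Function.Injective, Fin.forall_fin_two, eq_comm] using hij
  rw [← expect_product', univ_product_univ,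
    ← Fintype.expect_equiv (finTwoArrowEquiv V) (fun ψ => f (ψ 0) (ψ 1)) _ fun _ => rfl,
    ← expect_comp_injective hq]
  rfl

open Classical in
theorem expect_not_injective_le [Nonempty V] :
    𝔼 φ : ι → V, (if φ.Injective then 0 else 1 : ℝ) ≤ Fintype.card ι ^ 2 / Fintype.card V := by
  have collision (p : ι × ι) (hp : p ∈ (univ : Finset ι).offDiag) :
      𝔼 φ : ι → V, (if φ p.1 = φ p.2 then 1 else 0 : ℝ) = 1 / Fintype.card V := by
    rw [expect_apply_apply (mem_offDiag.1 hp).2.2 fun x y => if x = y then 1 else 0]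
    simp
  calc 𝔼 φ : ι → V, (if φ.Injective then 0 else 1 : ℝ)
      ≤ 𝔼 φ : ι → V, ∑ p ∈ (univ : Finset ι).offDiag, (if φ p.1 = φ p.2 then 1 else 0) := by
        refine expect_le_expect fun φ _ => ?_
        split_ifs with hφ
        · positivity
        · obtain ⟨i, j, hφij, hij⟩ := Function.not_injective_iff.1 hφ
          have hmem : (i, j) ∈ (univ : Finset ι).offDiag := by simp [hij]
          calc (1 : ℝ) = if φ i = φ j then 1 else 0 := (if_pos hφij).symm
            _ ≤ _ := single_le_sum (f := fun p : ι × ι => if φ p.1 = φ p.2 then (1 : ℝ) else 0)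
              (fun _ _ => by positivity) hmem
    _ = #(univ : Finset ι).offDiag * (1 / Fintype.card V) := by
        rw [expect_sum_comm, sum_congr rfl collision, sum_const, nsmul_eq_mul]
    _ ≤ Fintype.card ι ^ 2 / Fintype.card V := by
        rw [mul_one_div]
        gcongr
        rw [offDiag_card, card_univ, sq]
        exact_mod_cast Nat.sub_le _ _

-- Jensen's inequality once per coordinate `i : Fin k`: the vertices chosen from `i` are averaged
-- with the other coordinates fixed, and then the remaining coordinates are blown up.
theorem pow_expect_le_expect_prod_blowup [Nonempty V] {k : ℕ} {f : (Fin k → V) → ℝ}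
    (hf : ∀ ψ, 0 ≤ f ψ) :
    (𝔼 ψ, f ψ) ^ Fintype.card σ ^ k
      ≤ 𝔼 g : Fin k → σ → V, ∏ j : Fin k → σ, f fun i => g i (j i) := by
  induction k with
  | zero => simp [Subsingleton.elim (fun _ => _) (default : Fin 0 → V)]
  | succ k ih =>
    have blowup_nonneg (h : σ → V) (ψ : Fin k → V) : 0 ≤ ∏ s, f (Fin.cons (h s) ψ) :=
      prod_nonneg fun _ _ => hf _
    calc (𝔼 ψ, f ψ) ^ Fintype.card σ ^ (k + 1)
        = ((𝔼 ψ : Fin k → V, 𝔼 x, f (Fin.cons x ψ)) ^ Fintype.card σ) ^ Fintype.card σ ^ k := by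
          rw [expect_fin_succ_arrow, expect_comm, ← pow_mul, pow_succ']
      _ ≤ (𝔼 ψ : Fin k → V, (𝔼 x, f (Fin.cons x ψ)) ^ Fintype.card σ) ^ Fintype.card σ ^ k := by
          gcongr
          · exact pow_nonneg (expect_nonneg fun _ _ => expect_nonneg fun _ _ => hf _) _
          · exact pow_expect_le_expect_pow (fun _ => expect_nonneg fun _ _ => hf _) _
      _ = (𝔼 h : σ → V, 𝔼 ψ : Fin k → V, ∏ s, f (Fin.cons (h s) ψ)) ^ Fintype.card σ ^ k := by
          simp only [expect_pow_card_eq_expect_prod]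
          rw [expect_comm]
      _ ≤ 𝔼 h : σ → V, (𝔼 ψ : Fin k → V, ∏ s, f (Fin.cons (h s) ψ)) ^ Fintype.card σ ^ k :=
          pow_expect_le_expect_pow (fun h => expect_nonneg fun ψ _ => blowup_nonneg h ψ) _
      _ ≤ 𝔼 h : σ → V, 𝔼 g : Fin k → σ → V,
            ∏ j : Fin k → σ, ∏ s, f (Fin.cons (h s) fun i => g i (j i)) :=
          expect_le_expect fun h _ => ih (blowup_nonneg h)
      _ = 𝔼 g : Fin (k + 1) → σ → V, ∏ j : Fin (k + 1) → σ, f fun i => g i (j i) := by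
          rw [expect_fin_succ_arrow]
          refine expect_congr rfl fun h _ => expect_congr rfl fun g _ => ?_
          rw [Finset.prod_comm, ← Fintype.prod_prod_type']
          refine Fintype.prod_equiv (Fin.consEquiv fun _ => σ) _ _ fun p => ?_
          congr 1
          funext i
          cases i using Fin.cases <;> rfl

end Averaging

section ExtremalBound

-- The parts `S` are peeled off `U` one by one.
theorem sum_sum_le_of_forall_exists_light {V : Type*} {w : V → V → ℝ}
    (symm : ∀ x y, w x y = w y x) {α : ℝ}
    (light : ∀ U : Finset V, U.Nonempty →
      ∃ S ⊆ U, S.Nonempty ∧ ∀ v ∈ U, ∑ y ∈ S, w v y ≤ α * #S)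
    (U : Finset V) : ∑ x ∈ U, ∑ y ∈ U, w x y ≤ α * #U ^ 2 := by
  classical
  induction U using Finset.strongInduction with
  | H U ih =>
    obtain rfl | hU := U.eq_empty_or_nonempty
    · simp
    obtain ⟨S, hSU, hS, hlight⟩ := light U hU
    have card_U : (#U : ℝ) = #(U \ S) + #S := by
      exact_mod_cast (card_sdiff_add_card_eq_card hSU).symm
    have from_rest : ∑ x ∈ U \ S, ∑ y ∈ S, w x y ≤ #(U \ S) * (α * #S) := by
      simpa using sum_le_card_nsmul (U \ S) _ _ fun x hx => hlight x (sdiff_subset hx)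
    have from_S : ∑ x ∈ S, ∑ y ∈ S, w x y ≤ #S * (α * #S) := by
      simpa using sum_le_card_nsmul S _ _ fun x hx => hlight x (hSU hx)
    have to_rest : ∑ x ∈ S, ∑ y ∈ U \ S, w x y = ∑ x ∈ U \ S, ∑ y ∈ S, w x y := by
      rw [sum_comm]
      simp only [symm]
    have inside_rest := ih (U \ S) (sdiff_ssubset hSU hS)
    simp only [← sum_sdiff hSU, sum_add_distrib, to_rest, card_U]
    linarith

end ExtremalBound

section Supersaturation

variable {ι κ V : Type*} [Fintype ι] [Nonempty ι] [Fintype κ] [DecidableEq κ] [Fintype V]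
  [Nonempty V]

theorem one_sub_mul_expect_le_expect_expect [DecidableEq ι] {w : V → V → ℝ} (hw : ∀ x, 0 ≤ w x x) :
    (1 - 1 / Fintype.card ι : ℝ) * 𝔼 x, 𝔼 y, w x y
      ≤ 𝔼 φ : ι → V, 𝔼 i, 𝔼 j, w (φ i) (φ j) := by
  calc (1 - 1 / Fintype.card ι : ℝ) * 𝔼 x, 𝔼 y, w x y
      = 𝔼 i : ι, 𝔼 j, ((𝔼 x, 𝔼 y, w x y) - if i = j then 𝔼 x, 𝔼 y, w x y else 0) := by
        simp [expect_sub_distrib, NNRat.smul_def]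
        ring
    _ ≤ 𝔼 i, 𝔼 j, 𝔼 φ : ι → V, w (φ i) (φ j) := by
        refine expect_le_expect fun i _ => expect_le_expect fun j _ => ?_
        split_ifs with hij
        · rw [sub_self]
          exact expect_nonneg fun φ _ => hij ▸ hw (φ i)
        · rw [sub_zero, expect_apply_apply hij]
    _ = 𝔼 φ : ι → V, 𝔼 i, 𝔼 j, w (φ i) (φ j) :=
        (expect_congr rfl fun i _ => expect_comm _ _ _).trans (expect_comm _ _ _)

-- The maps `φ : ι → V` in which the pattern `P` occurs are charged to the density of `P`.
open Classical in
theorem one_sub_mul_expect_le_of_forall_pattern_free {w : V → V → ℝ} {α B : ℝ} (hα : 0 ≤ α)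
    (hw : ∀ x y, 0 ≤ w x y) (hwB : ∀ x y, w x y ≤ B) (P : (κ → V) → Prop)
    (pattern_free : ∀ φ : ι → V, (∀ q : κ ↪ ι, ¬ P (φ ∘ q)) → 𝔼 i, 𝔼 j, w (φ i) (φ j) ≤ α) :
    (1 - 1 / Fintype.card ι : ℝ) * 𝔼 x, 𝔼 y, w x y
      ≤ α + B * (Fintype.card ι ^ Fintype.card κ * 𝔼 ψ, if P ψ then 1 else 0) := by
  have B_nonneg : 0 ≤ B := ‹Nonempty V›.elim fun x => (hw x x).trans (hwB x x)
  have pointwise (φ : ι → V) : 𝔼 i, 𝔼 j, w (φ i) (φ j)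
      ≤ α + B * ∑ q : κ ↪ ι, if P (φ ∘ q) then 1 else 0 := by
    by_cases h : ∃ q : κ ↪ ι, P (φ ∘ q)
    · obtain ⟨q, hq⟩ := h
      have occurrence : (1 : ℝ) ≤ ∑ q : κ ↪ ι, if P (φ ∘ q) then 1 else 0 := by
        calc (1 : ℝ) = if P (φ ∘ q) then 1 else 0 := (if_pos hq).symm
          _ ≤ _ := single_le_sum (f := fun q : κ ↪ ι => if P (φ ∘ q) then (1 : ℝ) else 0)
            (fun _ _ => by positivity) (mem_univ q)
      have trivial_bound : 𝔼 i, 𝔼 j, w (φ i) (φ j) ≤ B :=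
        expect_le univ_nonempty fun i _ => expect_le univ_nonempty fun j _ => hwB _ _
      nlinarith
    · have := pattern_free φ (not_exists.1 h)
      have : 0 ≤ B * ∑ q : κ ↪ ι, if P (φ ∘ q) then (1 : ℝ) else 0 := by positivity
      linarith
  calc (1 - 1 / Fintype.card ι : ℝ) * 𝔼 x, 𝔼 y, w x y
      ≤ 𝔼 φ : ι → V, 𝔼 i, 𝔼 j, w (φ i) (φ j) :=
        one_sub_mul_expect_le_expect_expect fun x => hw x x
    _ ≤ 𝔼 φ : ι → V, (α + B * ∑ q : κ ↪ ι, if P (φ ∘ q) then 1 else 0) :=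
        expect_le_expect fun φ _ => pointwise φ
    _ = α + B * (Fintype.card (κ ↪ ι) * 𝔼 ψ, if P ψ then 1 else 0) := by
        rw [expect_add_distrib, Fintype.expect_const, ← mul_expect, expect_sum_comm]
        simp only [expect_comp_injective (Function.Embedding.injective _)
          fun ψ => if P ψ then (1 : ℝ) else 0, sum_const, card_univ, nsmul_eq_mul]
    _ ≤ _ := by
        gcongr
        rw [Fintype.card_embedding_eq]
        exact_mod_cast Nat.descFactorial_le_pow _ _

end Supersaturation

namespace TwoColoredGraph

section Basic

variable {U V W : Type*} {F : TwoColoredGraph U} {G : TwoColoredGraph V} {H : TwoColoredGraph W}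

/-- The graph of the pairs that carry at least one color. -/
def underlying (G : TwoColoredGraph V) : SimpleGraph V := G.red ⊔ G.blue

/-- The 2-coloring that `G` induces along a map `φ` into its vertices; `φ` need not be injective,
and pairs that it identifies carry no color. -/
def comap (φ : U → V) (G : TwoColoredGraph V) : TwoColoredGraph U :=
  ⟨G.red.comap φ, G.blue.comap φ⟩

open Classical in
/-- The number of colors of the pair `xy`, which is its multiplicity as an edge. -/
noncomputable def mult (G : TwoColoredGraph V) (x y : V) : ℕ :=
  (if G.red.Adj x y then 1 else 0) + (if G.blue.Adj x y then 1 else 0)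

theorem mult_comm (x y : V) : G.mult x y = G.mult y x := by
  rw [mult, mult, G.red.adj_comm, G.blue.adj_comm]

theorem mult_le_two (x y : V) : G.mult x y ≤ 2 := by
  unfold mult
  split_ifs <;> norm_num

theorem mult_eq_two_iff {x y : V} : G.mult x y = 2 ↔ G.red.Adj x y ∧ G.blue.Adj x y := by
  unfold mult
  split_ifs <;> simp_all

theorem mult_pos_iff {x y : V} : 0 < G.mult x y ↔ G.underlying.Adj x y := by
  unfold mult underlying
  split_ifs <;> simp_all

theorem ne_of_mult_pos {x y : V} (h : 0 < G.mult x y) : x ≠ y :=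
  (mult_pos_iff.1 h).ne

theorem sum_sum_mult [Fintype V] :
    ∑ x, ∑ y, G.mult x y = 2 * (G.red.edgeSet.ncard + G.blue.edgeSet.ncard) := by
  classical
  have degree_sum (S : SimpleGraph V) :
      ∑ x, ∑ y, (if S.Adj x y then 1 else 0) = 2 * S.edgeSet.ncard := by
    rw [← SimpleGraph.coe_edgeFinset, Set.ncard_coe_finset, SimpleGraph.two_mul_card_edgeFinset,
      card_filter, Fintype.sum_prod_type]
  simp only [mult, sum_add_distrib, mul_add, ← degree_sum]

theorem IsHom.underlying_adj {f : W → V} (hf : H.IsHom G f) {u v : W}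
    (huv : H.underlying.Adj u v) : G.underlying.Adj (f u) (f v) :=
  huv.imp (hf.1 u v) (hf.2 u v)

theorem IsHom.injective_of_underlying_eq_top {f : W → V} (hf : H.IsHom G f)
    (hH : H.underlying = ⊤) : f.Injective := fun u v huv => by
  by_contra hne
  exact (hf.underlying_adj (hH ▸ hne : H.underlying.Adj u v)).ne huv

theorem IsHom.of_forall_choice {c : W → U} (hc : H.IsHom F c) {g : U → W → V}
    (hg : ∀ j : U → W, F.IsHom G fun i => g i (j i)) : H.IsHom G fun v => g (c v) v := by
  classical
  refine ⟨fun u v huv => ?_, fun u v huv => ?_⟩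
  · have hcuv := hc.1 u v huv
    simpa [hcuv.ne] using (hg (Function.update (fun _ => u) (c v) v)).1 _ _ hcuv
  · have hcuv := hc.2 u v huv
    simpa [hcuv.ne] using (hg (Function.update (fun _ => u) (c v) v)).2 _ _ hcuv

theorem isHom_ofEdges {n : ℕ} {r b : List (ℕ × ℕ)} {f : Fin n → V}
    (hr : ∀ i j : Fin n, ((i : ℕ) + 1, (j : ℕ) + 1) ∈ r → G.red.Adj (f i) (f j))
    (hb : ∀ i j : Fin n, ((i : ℕ) + 1, (j : ℕ) + 1) ∈ b → G.blue.Adj (f i) (f j)) :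
    (ofEdges n r b).IsHom G f :=
  ⟨fun i j h => h.2.elim (hr i j) fun h => (hr j i h).symm,
    fun i j h => h.2.elim (hb i j) fun h => (hb j i h).symm⟩

end Basic

section CrossedSquareFree

variable {V : Type*} {G : TwoColoredGraph V}

/-- `G` has no crossed square: no 4-cycle of pairs in both colors whose two diagonals are colored.
Every crossed square contains `T1` or `T2`. -/
def CrossedSquareFree (G : TwoColoredGraph V) : Prop :=
  ∀ ⦃a b c d⦄, G.mult a b = 2 → G.mult b c = 2 → G.mult c d = 2 → G.mult d a = 2 →
    0 < G.mult a c → G.mult b d = 0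

theorem crossedSquareFree_of_not_colorableBy (h₁ : ¬ T1.ColorableBy G) (h₂ : ¬ T2.ColorableBy G) :
    G.CrossedSquareFree := by
  intro a b c d hab hbc hcd hda hac
  by_contra hbd
  rw [mult_eq_two_iff] at hab hbc hcd hda
  rw [mult_pos_iff] at hac
  rw [← ne_eq, ← Nat.pos_iff_ne_zero, mult_pos_iff] at hbd
  have hba := And.intro hab.1.symm hab.2.symm
  have hdc := And.intro hcd.1.symm hcd.2.symm
  have had := And.intro hda.1.symm hda.2.symm
  -- Diagonals with a common color give `T1`, and differently colored ones give `T2`.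
  rcases hac with hac | hac <;> rcases hbd with hbd | hbd
  · exact h₁ ⟨![a, b, c, d], isHom_ofEdges (by simp [Fin.forall_fin_succ, *])
      (by simp [Fin.forall_fin_succ, *])⟩
  · refine h₂ ⟨![b, c, d, a], isHom_ofEdges ?_ ?_⟩ <;>
      simp [Fin.forall_fin_succ, hac.symm, *]
  · refine h₂ ⟨![a, b, c, d], isHom_ofEdges ?_ ?_⟩ <;>
      simp [Fin.forall_fin_succ, *]
  · refine h₁ ⟨![a, b, d, c], isHom_ofEdges ?_ ?_⟩ <;>
      simp [Fin.forall_fin_succ, *]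

theorem CrossedSquareFree.mult_add_mult_add_mult_le_of_triangle (hG : G.CrossedSquareFree)
    {a b c : V} (hab : G.mult a b = 2) (hac : G.mult a c = 2) (hbc : G.mult b c = 2)
    (v : V) : G.mult v a + G.mult v b + G.mult v c ≤ 4 := by
  have uncolored {x y z : V} (hxy : G.mult x y = 2) (hxz : G.mult x z = 2)
      (hyz : G.mult y z = 2) (hvx : G.mult v x = 2) (hvy : G.mult v y = 2) : G.mult v z = 0 := by
    rw [mult_comm] at hyz hvy ⊢
    exact hG hxz hyz hvy hvx (by omega)
  have hcb := (mult_comm c b).trans hbc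
  have hab₀ := uncolored hab hac hbc
  have hac₀ := uncolored hac hab hcb
  have hbc₀ := uncolored hbc ((mult_comm b a).trans hab) ((mult_comm c a).trans hac)
  have hva := G.mult_le_two v a
  have hvb := G.mult_le_two v b
  have hvc := G.mult_le_two v c
  omega

theorem CrossedSquareFree.mult_add_mult_add_mult_le_of_cherry (hG : G.CrossedSquareFree)
    {a b c v : V} (hab : G.mult a b = 2) (hac : G.mult a c = 2) (hbc : 0 < G.mult b c)
    (hvb : G.mult v a = 2 → G.mult v b ≠ 2) (hvc : G.mult v a = 2 → G.mult v c ≠ 2) :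
    G.mult v a + G.mult v b + G.mult v c ≤ 4 := by
  have uncolored (hvb : G.mult v b = 2) (hvc : G.mult v c = 2) : G.mult v a = 0 := by
    rw [mult_comm] at hab hvc ⊢
    exact hG hab hac hvc hvb hbc
  have hva_le := G.mult_le_two v a
  have hvb_le := G.mult_le_two v b
  have hvc_le := G.mult_le_two v c
  omega

theorem exists_light_triple {U : Finset V} {a b c : V} (ha : a ∈ U) (hb : b ∈ U) (hc : c ∈ U)
    (hab : 0 < G.mult a b) (hac : 0 < G.mult a c) (hbc : 0 < G.mult b c)
    (light : ∀ v ∈ U, G.mult v a + G.mult v b + G.mult v c ≤ 4) :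
    ∃ S ⊆ U, S.Nonempty ∧ ∀ v ∈ U, 3 * ∑ y ∈ S, G.mult v y ≤ 4 * #S := by
  classical
  have ne_ab := ne_of_mult_pos hab
  have ne_ac := ne_of_mult_pos hac
  have ne_bc := ne_of_mult_pos hbc
  refine ⟨{a, b, c}, by simp [insert_subset_iff, ha, hb, hc], by simp, fun v hv => ?_⟩
  rw [card_eq_three.2 ⟨a, b, c, ne_ab, ne_ac, ne_bc, rfl⟩, sum_insert (by simp [ne_ab, ne_ac]),
    sum_pair ne_bc]
  have := light v hv
  omega

theorem exists_light_pair {U : Finset V} {a b : V} (ha : a ∈ U) (hb : b ∈ U) (hab : a ≠ b)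
    (light : ∀ v ∈ U, G.mult v a + G.mult v b ≤ 2) :
    ∃ S ⊆ U, S.Nonempty ∧ ∀ v ∈ U, 3 * ∑ y ∈ S, G.mult v y ≤ 4 * #S := by
  classical
  refine ⟨{a, b}, by simp [insert_subset_iff, ha, hb], by simp, fun v hv => ?_⟩
  rw [card_pair hab, sum_pair hab]
  have := light v hv
  omega

theorem CrossedSquareFree.exists_light (hG : G.CrossedSquareFree) {U : Finset V}
    (hU : U.Nonempty) :
    ∃ S ⊆ U, S.Nonempty ∧ ∀ v ∈ U, 3 * ∑ y ∈ S, G.mult v y ≤ 4 * #S := by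
  by_cases triangle : ∃ a ∈ U, ∃ b ∈ U, ∃ c ∈ U, G.mult a b = 2 ∧ G.mult a c = 2 ∧ G.mult b c = 2
  · obtain ⟨a, ha, b, hb, c, hc, hab, hac, hbc⟩ := triangle
    exact exists_light_triple ha hb hc (by omega) (by omega) (by omega) fun v _ =>
      hG.mult_add_mult_add_mult_le_of_triangle hab hac hbc v
  by_cases cherry : ∃ a ∈ U, ∃ b ∈ U, ∃ c ∈ U, G.mult a b = 2 ∧ G.mult a c = 2 ∧ 0 < G.mult b c
  · obtain ⟨a, ha, b, hb, c, hc, hab, hac, hbc⟩ := cherry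
    exact exists_light_triple ha hb hc (by omega) (by omega) hbc fun v hv =>
      hG.mult_add_mult_add_mult_le_of_cherry hab hac hbc
        (fun hva hvb => triangle ⟨v, hv, a, ha, b, hb, hva, hvb, hab⟩)
        (fun hva hvc => triangle ⟨v, hv, a, ha, c, hc, hva, hvc, hac⟩)
  by_cases doubleEdge : ∃ a ∈ U, ∃ b ∈ U, G.mult a b = 2
  · obtain ⟨a, ha, b, hb, hab⟩ := doubleEdge
    refine exists_light_pair ha hb (ne_of_mult_pos (by omega : 0 < G.mult a b)) fun v hv => ?_
    have cherry_a : G.mult v a = 2 → G.mult v b = 0 := fun hva => by_contra fun hvb =>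
      cherry ⟨a, ha, v, hv, b, hb, (mult_comm a v).trans hva, hab, Nat.pos_of_ne_zero hvb⟩
    have cherry_b : G.mult v b = 2 → G.mult v a = 0 := fun hvb => by_contra fun hva =>
      cherry ⟨b, hb, v, hv, a, ha, (mult_comm b v).trans hvb, (mult_comm b a).trans hab,
        Nat.pos_of_ne_zero hva⟩
    have hva := G.mult_le_two v a
    have hvb := G.mult_le_two v b
    omega
  · obtain ⟨a, ha⟩ := hU
    refine ⟨{a}, by simpa using ha, singleton_nonempty a, fun v hv => ?_⟩
    rw [sum_singleton, card_singleton]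
    have hva : G.mult v a ≠ 2 := fun h => doubleEdge ⟨v, hv, a, ha, h⟩
    have hva_le := G.mult_le_two v a
    omega

theorem CrossedSquareFree.sum_sum_mult_le (hG : G.CrossedSquareFree) (U : Finset V) :
    ∑ x ∈ U, ∑ y ∈ U, (G.mult x y : ℝ) ≤ 4 / 3 * #U ^ 2 := by
  refine sum_sum_le_of_forall_exists_light (fun x y => by rw [mult_comm]) (fun U hU => ?_) U
  obtain ⟨S, hSU, hS, light⟩ := hG.exists_light hU
  refine ⟨S, hSU, hS, fun v hv => ?_⟩
  have : 3 * ∑ y ∈ S, (G.mult v y : ℝ) ≤ 4 * #S := by exact_mod_cast light v hv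
  linarith

end CrossedSquareFree

section HomDensity

variable {V W : Type*} [Fintype V]

open Classical in
/-- The homomorphism density of `H` in `G`: the probability that a uniformly random map of the
vertices of `H` to the vertices of `G` is a homomorphism. -/
noncomputable def homDensity [Fintype W] [DecidableEq W] (H : TwoColoredGraph W)
    (G : TwoColoredGraph V) : ℝ :=
  𝔼 φ : W → V, if H.IsHom G φ then 1 else 0

variable [Fintype W] {G : TwoColoredGraph V} {H : TwoColoredGraph W}

theorem homDensity_nonneg [DecidableEq W] : 0 ≤ H.homDensity G :=
  expect_nonneg fun _ _ => by positivity

variable [Nonempty V]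

open Classical in
theorem ColorableBy.homDensity_pow_le [DecidableEq W] {k : ℕ}
    {F : TwoColoredGraph (Fin k)} (hHF : H.ColorableBy F) :
    F.homDensity G ^ Fintype.card W ^ k ≤ H.homDensity G := by
  obtain ⟨c, hc⟩ := hHF
  have graph_injective : Function.Injective fun v => (c v, v) := fun _ _ h => congrArg Prod.snd h
  calc F.homDensity G ^ Fintype.card W ^ k
      ≤ 𝔼 g : Fin k → W → V, ∏ j : Fin k → W, if F.IsHom G (fun i => g i (j i)) then 1 else 0 :=
        pow_expect_le_expect_prod_blowup fun _ => by positivity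
    _ ≤ 𝔼 g : Fin k → W → V, if H.IsHom G (fun v => g (c v) v) then 1 else 0 := by
        refine expect_le_expect fun g _ => ?_
        rw [Fintype.prod_boole]
        split_ifs with hg hg'
        · rfl
        · exact absurd (hc.of_forall_choice hg) hg'
        · exact zero_le_one
        · rfl
    _ = 𝔼 φ : Fin k × W → V, if H.IsHom G (φ ∘ fun v => (c v, v)) then 1 else 0 :=
        (Fintype.expect_equiv (Equiv.curry (Fin k) W V) _ _ fun _ => rfl).symm
    _ = H.homDensity G :=
        expect_comp_injective graph_injective fun ψ => if H.IsHom G ψ then 1 else 0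

theorem homDensity_le_of_not_contains [DecidableEq W] (hG : ¬ G.Contains H) :
    H.homDensity G ≤ Fintype.card W ^ 2 / Fintype.card V := by
  classical
  refine (expect_le_expect fun φ _ => ?_).trans (expect_not_injective_le (ι := W) (V := V))
  split_ifs with hφ hinj
  · exact absurd ⟨φ, hinj, hφ⟩ hG
  · rfl
  · rfl
  · exact zero_le_one

theorem ColorableBy.homDensity_le_of_not_contains [Nonempty W] {k : ℕ}
    {F : TwoColoredGraph (Fin k)} (hHF : H.ColorableBy F) (hG : ¬ G.Contains H) :
    F.homDensity G
      ≤ (Fintype.card W ^ 2 / Fintype.card V : ℝ) ^ ((Fintype.card W ^ k : ℕ) : ℝ)⁻¹ := by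
  classical
  rw [Real.le_rpow_inv_iff_of_pos homDensity_nonneg (by positivity) (by positivity),
    Real.rpow_natCast]
  exact hHF.homDensity_pow_le.trans (TwoColoredGraph.homDensity_le_of_not_contains hG)

end HomDensity

instance {n : ℕ} (r b : List (ℕ × ℕ)) : DecidableRel (ofEdges n r b).red.Adj := fun i j =>
  inferInstanceAs (Decidable (i ≠ j ∧ (_ ∈ r ∨ _ ∈ r)))

instance {n : ℕ} (r b : List (ℕ × ℕ)) : DecidableRel (ofEdges n r b).blue.Adj := fun i j =>
  inferInstanceAs (Decidable (i ≠ j ∧ (_ ∈ b ∨ _ ∈ b)))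

instance : DecidableRel T.red.Adj := inferInstanceAs (DecidableRel (ofEdges _ _ _).red.Adj)
instance : DecidableRel T.blue.Adj := inferInstanceAs (DecidableRel (ofEdges _ _ _).blue.Adj)
instance : DecidableRel T1.red.Adj := inferInstanceAs (DecidableRel (ofEdges _ _ _).red.Adj)
instance : DecidableRel T1.blue.Adj := inferInstanceAs (DecidableRel (ofEdges _ _ _).blue.Adj)
instance : DecidableRel T2.red.Adj := inferInstanceAs (DecidableRel (ofEdges _ _ _).red.Adj)
instance : DecidableRel T2.blue.Adj := inferInstanceAs (DecidableRel (ofEdges _ _ _).blue.Adj)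
instance : DecidableRel H8.red.Adj := inferInstanceAs (DecidableRel (ofEdges _ _ _).red.Adj)
instance : DecidableRel H8.blue.Adj := inferInstanceAs (DecidableRel (ofEdges _ _ _).blue.Adj)

instance {V : Type*} (G : TwoColoredGraph V) [DecidableRel G.red.Adj] [DecidableRel G.blue.Adj] :
    DecidableRel G.underlying.Adj :=
  inferInstanceAs (DecidableRel (G.red ⊔ G.blue).Adj)

theorem underlying_T1 : T1.underlying = ⊤ := by
  ext u v
  revert u v
  decide

theorem underlying_T2 : T2.underlying = ⊤ := by
  ext u v
  revert u v
  decide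

section UpperBound

theorem expect_mult_comap_le {ι V : Type*} [Fintype ι] [Nonempty ι] {G : TwoColoredGraph V}
    {φ : ι → V} (hφ : ∀ q : Fin 4 ↪ ι, ¬ (T1.IsHom G (φ ∘ q) ∨ T2.IsHom G (φ ∘ q))) :
    𝔼 i, 𝔼 j, (G.mult (φ i) (φ j) : ℝ) ≤ 4 / 3 := by
  have square_free : (G.comap φ).CrossedSquareFree := by
    refine crossedSquareFree_of_not_colorableBy ?_ ?_
    · rintro ⟨ψ, hψ⟩
      exact hφ ⟨ψ, hψ.injective_of_underlying_eq_top underlying_T1⟩ (Or.inl hψ)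
    · rintro ⟨ψ, hψ⟩
      exact hφ ⟨ψ, hψ.injective_of_underlying_eq_top underlying_T2⟩ (Or.inr hψ)
  have total : ∑ i, ∑ j, (G.mult (φ i) (φ j) : ℝ) ≤ 4 / 3 * Fintype.card ι ^ 2 :=
    square_free.sum_sum_mult_le univ
  simp only [Fintype.expect_eq_sum_div_card, ← sum_div, div_div]
  rwa [div_le_iff₀ (by positivity), ← sq]

theorem expect_expect_mult {n : ℕ} (hn : 2 ≤ n) (G : TwoColoredGraph (Fin n)) :
    𝔼 x, 𝔼 y, (G.mult x y : ℝ) = (1 - 1 / n) * G.edgeDensity := by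
  have total : ∑ x, ∑ y, (G.mult x y : ℝ)
      = 2 * (G.red.edgeSet.ncard + G.blue.edgeSet.ncard) := by
    exact_mod_cast G.sum_sum_mult
  have hn' : (2 : ℝ) ≤ n := by exact_mod_cast hn
  have : (n : ℝ) - 1 ≠ 0 := by linarith
  simp only [Fintype.expect_eq_sum_div_card, ← sum_div, div_div, total, edgeDensity,
    Nat.cast_choose_two, Fintype.card_fin]
  field_simp

theorem one_sub_mul_edgeDensity_le {m n : ℕ} (hm : 0 < m) (hn : 2 ≤ n)
    (G : TwoColoredGraph (Fin n)) :
    (1 - 1 / m) * ((1 - 1 / n) * G.edgeDensity)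
      ≤ 4 / 3 + 2 * (m ^ 4 * (T1.homDensity G + T2.homDensity G)) := by
  classical
  have : Nonempty (Fin m) := ⟨⟨0, hm⟩⟩
  have : Nonempty (Fin n) := ⟨⟨0, by omega⟩⟩
  have averaged := one_sub_mul_expect_le_of_forall_pattern_free (ι := Fin m) (α := 4 / 3) (B := 2)
    (by norm_num) (w := fun x y => (G.mult x y : ℝ)) (fun _ _ => by positivity)
    (fun x y => by exact_mod_cast G.mult_le_two x y)
    (fun ψ : Fin 4 → Fin n => T1.IsHom G ψ ∨ T2.IsHom G ψ) fun φ => expect_mult_comap_le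
  rw [expect_expect_mult hn, Fintype.card_fin, Fintype.card_fin] at averaged
  refine averaged.trans ?_
  gcongr
  rw [homDensity, homDensity, ← expect_add_distrib]
  refine expect_le_expect fun ψ _ => ?_
  split_ifs <;> simp_all

theorem one_sub_one_div_natCast_pos {k : ℕ} (hk : 2 ≤ k) : (0 : ℝ) < 1 - 1 / k :=
  sub_pos.2 ((div_lt_one (by positivity)).2 (by exact_mod_cast hk))

theorem edgeDensity_le_of_homDensity_le {m n : ℕ} (hm : 2 ≤ m) (hn : 2 ≤ n)
    {G : TwoColoredGraph (Fin n)} {τ : ℝ} (h₁ : T1.homDensity G ≤ τ) (h₂ : T2.homDensity G ≤ τ) :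
    G.edgeDensity ≤ (4 / 3 + 4 * m ^ 4 * τ) / ((1 - 1 / m) * (1 - 1 / n)) := by
  rw [le_div_iff₀ (mul_pos (one_sub_one_div_natCast_pos hm) (one_sub_one_div_natCast_pos hn))]
  calc G.edgeDensity * ((1 - 1 / m) * (1 - 1 / n))
      = (1 - 1 / m) * ((1 - 1 / n) * G.edgeDensity) := by ring
    _ ≤ 4 / 3 + 2 * (m ^ 4 * (T1.homDensity G + T2.homDensity G)) :=
      one_sub_mul_edgeDensity_le (by omega) hn G
    _ ≤ 4 / 3 + 2 * (m ^ 4 * (τ + τ)) := by gcongr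
    _ = 4 / 3 + 4 * m ^ 4 * τ := by ring

theorem maxDensity_le_of_colorableBy {W : Type*} [Fintype W] [Nonempty W] {H : TwoColoredGraph W}
    (h₁ : H.ColorableBy T1) (h₂ : H.ColorableBy T2) {m n : ℕ} (hm : 2 ≤ m) (hn : 2 ≤ n) :
    H.maxDensity n
      ≤ (4 / 3 + 4 * m ^ 4 * (Fintype.card W ^ 2 / n) ^ ((Fintype.card W ^ 4 : ℕ) : ℝ)⁻¹)
        / ((1 - 1 / m) * (1 - 1 / n)) := by
  have hm₀ := one_sub_one_div_natCast_pos hm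
  have hn₀ := one_sub_one_div_natCast_pos hn
  have : Nonempty (Fin n) := ⟨⟨0, by omega⟩⟩
  refine Real.sSup_le ?_ (by positivity)
  rintro _ ⟨G, hG, rfl⟩
  refine edgeDensity_le_of_homDensity_le hm hn ?_ ?_
  · simpa only [Fintype.card_fin] using h₁.homDensity_le_of_not_contains hG
  · simpa only [Fintype.card_fin] using h₂.homDensity_le_of_not_contains hG

theorem tendsto_one_sub_one_div_natCast :
    Tendsto (fun n : ℕ => 1 - 1 / (n : ℝ)) atTop (𝓝 1) := by
  simpa using (tendsto_const_div_atTop_nhds_zero_nat (1 : ℝ)).const_sub 1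

theorem tendsto_div_natCast_rpow (c : ℝ) {s : ℝ} (hs : 0 < s) :
    Tendsto (fun n : ℕ => (c / n) ^ s) atTop (𝓝 0) := by
  simpa [hs.ne'] using (tendsto_const_div_atTop_nhds_zero_nat c).rpow_const (Or.inr hs.le)

theorem eventually_maxDensity_lt {W : Type*} [Finite W] [Nonempty W] {H : TwoColoredGraph W}
    (h₁ : H.ColorableBy T1) (h₂ : H.ColorableBy T2) {a : ℝ} (ha : 4 / 3 < a) :
    ∀ᶠ n : ℕ in atTop, H.maxDensity n < a := by
  have := Fintype.ofFinite W
  have m_limit : Tendsto (fun m : ℕ => 4 / 3 / ((1 - 1 / m : ℝ) * 1)) atTop (𝓝 (4 / 3)) := by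
    simpa only [mul_one, div_one, Pi.div_def] using
      tendsto_const_nhds.div tendsto_one_sub_one_div_natCast one_ne_zero
  obtain ⟨m, hma, hm⟩ := ((m_limit.eventually_lt_const ha).and (eventually_ge_atTop 2)).exists
  have exponent_pos : 0 < ((Fintype.card W ^ 4 : ℕ) : ℝ)⁻¹ := by positivity
  have numerator := ((tendsto_div_natCast_rpow (Fintype.card W ^ 2) exponent_pos).const_mul
    (4 * (m : ℝ) ^ 4)).const_add (4 / 3)
  have denominator := tendsto_one_sub_one_div_natCast.const_mul (1 - 1 / m : ℝ)
  rw [mul_zero, add_zero] at numerator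
  have n_limit := numerator.div denominator
    (mul_pos (one_sub_one_div_natCast_pos hm) one_pos).ne'
  filter_upwards [n_limit.eventually_lt_const hma, eventually_ge_atTop 2] with n hna hn
  exact (maxDensity_le_of_colorableBy h₁ h₂ hm hn).trans_lt hna

end UpperBound

section LowerBound

/-- The balanced complete `r`-partite graph on `n` vertices with every edge in both colors. -/
def doubleTuran (n r : ℕ) : TwoColoredGraph (Fin n) :=
  ⟨SimpleGraph.turanGraph n r, SimpleGraph.turanGraph n r⟩

theorem underlying_doubleTuran_colorable (n : ℕ) {r : ℕ} (hr : 0 < r) :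
    (doubleTuran n r).underlying.Colorable r :=
  ⟨.mk (fun v => ⟨v % r, Nat.mod_lt _ hr⟩) fun h huv =>
    h.elim (· (Fin.mk.inj_iff.1 huv)) (· (Fin.mk.inj_iff.1 huv))⟩

theorem ColorableBy.underlying_colorable {V W : Type*} {G : TwoColoredGraph V}
    {H : TwoColoredGraph W} (hHG : H.ColorableBy G) {r : ℕ} (hG : G.underlying.Colorable r) :
    H.underlying.Colorable r :=
  let ⟨f, hf⟩ := hHG
  hG.of_hom ⟨f, hf.underlying_adj⟩

theorem not_contains_doubleTuran {W : Type*} {H : TwoColoredGraph W} (n : ℕ) {r : ℕ} (hr : 0 < r)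
    (hH : ¬ H.underlying.Colorable r) : ¬ (doubleTuran n r).Contains H :=
  fun ⟨f, _, hf⟩ => hH <| ColorableBy.underlying_colorable ⟨f, hf⟩ <|
    underlying_doubleTuran_colorable n hr

theorem choose_two_le_mul_card_edgeFinset_turanGraph (n : ℕ) {r : ℕ} (hr : 0 < r) :
    (r - 1) * n.choose 2 ≤ r * #(SimpleGraph.turanGraph n r).edgeFinset := by
  induction n using Nat.strong_induction_on with
  | _ n ih =>
    obtain hnr | hrn := lt_or_ge n r
    · have complete : #(SimpleGraph.turanGraph n r).edgeFinset = n.choose 2 := by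
        simp [SimpleGraph.card_edgeFinset_turanGraph, Nat.mod_eq_of_lt hnr]
      rw [complete]
      gcongr
      exact r.sub_le 1
    · obtain ⟨k, rfl⟩ := Nat.exists_eq_add_of_le' hrn
      have choose_add : (k + r).choose 2 = k.choose 2 + k * r + r.choose 2 := by
        simp [Nat.add_choose_eq, Finset.Nat.antidiagonal_succ]
        ring
      calc (r - 1) * (k + r).choose 2
          = (r - 1) * k.choose 2 + r * (k * (r - 1)) + (r - 1) * r.choose 2 := by
            rw [choose_add]
            ring
        _ ≤ r * #(SimpleGraph.turanGraph k r).edgeFinset + r * (k * (r - 1))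
              + r * r.choose 2 :=
            add_le_add (Nat.add_le_add_right (ih k (by omega)) _)
              (Nat.mul_le_mul_right _ (r.sub_le 1))
        _ = r * #(SimpleGraph.turanGraph (k + r) r).edgeFinset := by
            rw [SimpleGraph.card_edgeFinset_turanGraph_add]
            ring

theorem le_edgeDensity_doubleTuran {n r : ℕ} (hn : 2 ≤ n) (hr : 0 < r) :
    2 * (r - 1) / r ≤ (doubleTuran n r).edgeDensity := by
  have edges := choose_two_le_mul_card_edgeFinset_turanGraph n hr
  rw [← @Nat.cast_le ℝ] at edges
  push_cast [Nat.cast_sub hr] at edges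
  have : (0 : ℝ) < n.choose 2 := by exact_mod_cast Nat.choose_pos hn
  simp only [edgeDensity, doubleTuran, ← SimpleGraph.coe_edgeFinset, Set.ncard_coe_finset]
  rw [div_le_div_iff₀ (by positivity) this]
  linarith

theorem edgeDensity_le_maxDensity {W : Type*} {H : TwoColoredGraph W} {n : ℕ}
    {G : TwoColoredGraph (Fin n)} (hG : ¬ G.Contains H) : G.edgeDensity ≤ H.maxDensity n := by
  have : Finite (TwoColoredGraph (Fin n)) :=
    Finite.of_injective (fun G => (G.red, G.blue)) fun ⟨_, _⟩ ⟨_, _⟩ h => by simpa using h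
  refine le_csSup (((Set.finite_range (edgeDensity (n := n))).subset ?_).bddAbove) ⟨G, hG, rfl⟩
  rintro _ ⟨G, -, rfl⟩
  exact ⟨G, rfl⟩

end LowerBound

theorem hasTuranDensity_four_thirds {W : Type*} [Finite W] {H : TwoColoredGraph W}
    (h₁ : H.ColorableBy T1) (h₂ : H.ColorableBy T2) (hH : ¬ H.underlying.Colorable 3) :
    H.HasTuranDensity (4 / 3) := by
  have : Nonempty W := not_isEmpty_iff.1 fun _ => hH (.of_isEmpty _)
  refine tendsto_order.2 ⟨fun a ha => ?_, fun a ha => eventually_maxDensity_lt h₁ h₂ ha⟩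
  filter_upwards [eventually_ge_atTop 2] with n hn
  calc a < 4 / 3 := ha
    _ ≤ (doubleTuran n 3).edgeDensity := by
      convert le_edgeDensity_doubleTuran hn three_pos using 1
      norm_num
    _ ≤ H.maxDensity n := edgeDensity_le_maxDensity (not_contains_doubleTuran n three_pos hH)

section H8

theorem H8_colorableBy_T1 : H8.ColorableBy T1 :=
  ⟨![0, 1, 2, 3, 3, 2, 0, 1], by decide, by decide⟩

theorem H8_colorableBy_T2 : H8.ColorableBy T2 :=
  ⟨![1, 3, 3, 1, 0, 2, 2, 0], by decide, by decide⟩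

theorem card_le_of_indepSetFree_of_colorable {V : Type*} [Fintype V] {S : SimpleGraph V}
    {k r : ℕ} (hS : S.IndepSetFree (k + 1)) (hr : S.Colorable r) : Fintype.card V ≤ k * r := by
  classical
  obtain ⟨c⟩ := hr
  have colorClass_card (i : Fin r) : #{v | c v = i} ≤ k := by
    by_contra! hk
    obtain ⟨t, ht, card_t⟩ := exists_subset_card_eq (Nat.succ_le_of_lt hk)
    have color_eq {v} (hv : v ∈ t) : c v = i := (mem_filter.1 (ht hv)).2
    exact hS t ⟨fun u hu v hv _ huv => c.valid huv ((color_eq hu).trans (color_eq hv).symm), card_t⟩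
  simpa using card_le_mul_card_image_of_maps_to (fun v _ => mem_univ (c v)) k
    fun i _ => colorClass_card i

theorem indepSetFree_three_underlying_H8 : H8.underlying.IndepSetFree 3 := by
  have adjacent_pair : ∀ u v w, u ≠ v → u ≠ w → v ≠ w →
      H8.underlying.Adj u v ∨ H8.underlying.Adj u w ∨ H8.underlying.Adj v w := by decide
  rw [← SimpleGraph.cliqueFree_compl]
  intro s hs
  obtain ⟨u, v, w, huv, huw, hvw, -⟩ := SimpleGraph.is3Clique_iff.1 hs
  rw [SimpleGraph.compl_adj] at huv huw hvw
  have := adjacent_pair u v w huv.1 huw.1 hvw.1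
  tauto

theorem not_colorable_three_underlying_H8 : ¬ H8.underlying.Colorable 3 := fun h => by
  simpa using card_le_of_indepSetFree_of_colorable indepSetFree_three_underlying_H8 h

theorem colorable_three_underlying_T : T.underlying.Colorable 3 :=
  ⟨.mk ![0, 1, 2, 0] (by decide)⟩

theorem H8_not_colorableBy_T : ¬ H8.ColorableBy T := fun h =>
  not_colorable_three_underlying_H8 (h.underlying_colorable colorable_three_underlying_T)

end H8

end TwoColoredGraph

theorem lemma3p7 :
    TwoColoredGraph.H8.HasTuranDensity (4 / 3) ∧
      TwoColoredGraph.H8.ColorableBy TwoColoredGraph.T1 ∧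
      TwoColoredGraph.H8.ColorableBy TwoColoredGraph.T2 ∧
      ¬ TwoColoredGraph.H8.ColorableBy TwoColoredGraph.T :=
  open TwoColoredGraph in
  ⟨hasTuranDensity_four_thirds H8_colorableBy_T1 H8_colorableBy_T2
    not_colorable_three_underlying_H8, H8_colorableBy_T1, H8_colorableBy_T2, H8_not_colorableBy_T⟩
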